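/- Corollary 3.6 (orientability). Let $k,n$ be integers with $0<k<n$, and let $\mathrm{Gr}(k,n)$ be the real Grassmannian of $k$-dimensional linear subspaces of $\mathbb{R}^n$, with its quotient topology as $\mathrm{GL}_k(\mathbb{R})\backslash\{A\in\mathbb{R}^{k\times n}:\operatorname{rank}A=k\}$ and its standard structure of a smooth manifold of dimension $k(n-k)$. Then $\mathrm{Gr}(k,n)$ is orientable, that is, its smooth structure admits an atlas of smooth charts whose coordinate changes all have positive Jacobian determinant, if and only if $n$ is even. -/

import Mathlib

open scoped Manifold ContDiff

noncomputable section

/-- The set of all `k`-dimensional linear subspaces of `ℝⁿ`. -/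
def RealGrassmannian (k n : ℕ) : Type :=
  {V : Submodule ℝ (Fin n → ℝ) // Module.finrank ℝ V = k}

namespace RealGrassmannian

variable {k n : ℕ}

/-- The `k × n` real matrices of rank `k`, with the topology of matrix space. -/
abbrev FullRank (k n : ℕ) : Type := {A : Matrix (Fin k) (Fin n) ℝ // A.rank = k}

/-- The subspace spanned by the rows of a full rank matrix. Two matrices have the same row space
exactly when they differ by the left action of `GL_k(ℝ)`. -/
def rowSpace (A : FullRank k n) : RealGrassmannian k n :=
  ⟨Submodule.span ℝ (Set.range A.1.row), A.1.rank_eq_finrank_span_row.symm.trans A.2⟩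

/-- The quotient topology of `GL_k(ℝ) \ {A : A is a k × n matrix of rank k}`. -/
instance : TopologicalSpace (RealGrassmannian k n) :=
  TopologicalSpace.coinduced rowSpace inferInstance

/-- The linear model space `Hom(ℝᵏ, ℝⁿ⁻ᵏ)`, of dimension `k (n - k)`. -/
abbrev Model (k n : ℕ) : Type := (Fin k → ℝ) →L[ℝ] (Fin (n - k) → ℝ)

/-- A splitting `ℝᵏ × ℝⁿ⁻ᵏ ≃ ℝⁿ`. -/
abbrev Splitting (k n : ℕ) : Type :=
  ((Fin k → ℝ) × (Fin (n - k) → ℝ)) ≃L[ℝ] (Fin n → ℝ)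

/-- The injection `x ↦ φ (x, B x)`, whose range is the graph of `B` in the splitting `φ`. -/
def graphMap (φ : Splitting k n) (B : Model k n) : (Fin k → ℝ) →L[ℝ] (Fin n → ℝ) :=
  (φ : _ →L[ℝ] (Fin n → ℝ)) ∘L ((ContinuousLinearMap.id ℝ (Fin k → ℝ)).prod B)

lemma graphMap_apply (φ : Splitting k n) (B : Model k n) (x : Fin k → ℝ) :
    graphMap φ B x = φ (x, B x) := rfl

lemma graphMap_injective (φ : Splitting k n) (B : Model k n) :
    Function.Injective (graphMap φ B) := by
  intro x y h
  exact congrArg Prod.fst (φ.injective h)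

/-- The graph of `B : ℝᵏ → ℝⁿ⁻ᵏ`, seen as a `k`-dimensional subspace of `ℝⁿ` through `φ`. -/
def graph (φ : Splitting k n) (B : Model k n) : RealGrassmannian k n :=
  ⟨LinearMap.range (graphMap φ B).toLinearMap, by
    rw [LinearMap.finrank_range_of_inj (graphMap_injective φ B)]; simp⟩

lemma graph_injective (φ : Splitting k n) : Function.Injective (graph φ) := by
  intro B C h
  ext1 x
  have hx : graphMap φ B x ∈ LinearMap.range (graphMap φ C).toLinearMap := by
    have hm : graphMap φ B x ∈ (graph φ B).1 := ⟨x, rfl⟩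
    rw [h] at hm
    exact hm
  obtain ⟨y, hy⟩ := hx
  have h2 := φ.injective hy
  have h3 : y = x := congrArg Prod.fst h2
  have h4 : C y = B x := congrArg Prod.snd h2
  rw [← h4, h3]

/-- The first component, in the splitting `φ`, of a linear map into `ℝⁿ`. -/
def fstPart (φ : Splitting k n) (F : (Fin k → ℝ) →L[ℝ] (Fin n → ℝ)) :
    (Fin k → ℝ) →L[ℝ] (Fin k → ℝ) :=
  (ContinuousLinearMap.fst ℝ (Fin k → ℝ) (Fin (n - k) → ℝ) ∘L
    (φ.symm : (Fin n → ℝ) →L[ℝ] (Fin k → ℝ) × (Fin (n - k) → ℝ))) ∘L F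

/-- The second component, in the splitting `φ`, of a linear map into `ℝⁿ`. -/
def sndPart (φ : Splitting k n) (F : (Fin k → ℝ) →L[ℝ] (Fin n → ℝ)) : Model k n :=
  (ContinuousLinearMap.snd ℝ (Fin k → ℝ) (Fin (n - k) → ℝ) ∘L
    (φ.symm : (Fin n → ℝ) →L[ℝ] (Fin k → ℝ) × (Fin (n - k) → ℝ))) ∘L F

lemma range_eq_graph (φ : Splitting k n) (F : (Fin k → ℝ) →L[ℝ] (Fin n → ℝ))
    (h : IsUnit (fstPart φ F)) :
    LinearMap.range F.toLinearMap = (graph φ (sndPart φ F ∘L Ring.inverse (fstPart φ F))).1 := by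
  obtain ⟨u, hu⟩ := h
  have e1 : ∀ x, fstPart φ F ((↑u⁻¹ : (Fin k → ℝ) →L[ℝ] (Fin k → ℝ)) x) = x := fun x => by
    rw [← hu]; exact congrArg (fun T : (Fin k → ℝ) →L[ℝ] (Fin k → ℝ) => T x) u.mul_inv
  have e2 : ∀ x, (↑u⁻¹ : (Fin k → ℝ) →L[ℝ] (Fin k → ℝ)) (fstPart φ F x) = x := fun x => by
    rw [← hu]; exact congrArg (fun T : (Fin k → ℝ) →L[ℝ] (Fin k → ℝ) => T x) u.inv_mul
  have key : ∀ x, F x = φ (fstPart φ F x, sndPart φ F x) := fun x => by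
    simp [fstPart, sndPart]
  have hinv : Ring.inverse (fstPart φ F) = ↑u⁻¹ := by rw [← hu, Ring.inverse_unit]
  rw [hinv]
  ext v
  constructor
  · rintro ⟨x, rfl⟩
    refine ⟨fstPart φ F x, ?_⟩
    change φ (_, sndPart φ F ((↑u⁻¹ : (Fin k → ℝ) →L[ℝ] (Fin k → ℝ)) (fstPart φ F x))) = F x
    rw [e2]
    exact (key x).symm
  · rintro ⟨x, rfl⟩
    refine ⟨(↑u⁻¹ : (Fin k → ℝ) →L[ℝ] (Fin k → ℝ)) x, ?_⟩
    change F _ = φ (x, sndPart φ F ((↑u⁻¹ : (Fin k → ℝ) →L[ℝ] (Fin k → ℝ)) x))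
    rw [key, e1]

lemma isUnit_fstPart (φ : Splitting k n) (F : (Fin k → ℝ) →L[ℝ] (Fin n → ℝ))
    (hF : Function.Injective F) (B : Model k n)
    (h : LinearMap.range F.toLinearMap = (graph φ B).1) : IsUnit (fstPart φ F) := by
  have hinj : Function.Injective (fstPart φ F) := by
    rw [injective_iff_map_eq_zero]
    intro x hx
    have hm : F x ∈ (graph φ B).1 := h ▸ ⟨x, rfl⟩
    obtain ⟨y, hy⟩ := hm
    have hy' : φ (y, B y) = F x := hy
    have : y = 0 := by
      rw [← hx]
      simp [fstPart, ← hy']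
    apply hF
    rw [← hy', this]
    simp
  have hb : Function.Bijective (fstPart φ F) :=
    ⟨hinj, LinearMap.surjective_of_injective (f := (fstPart φ F).toLinearMap) hinj⟩
  let e : (Fin k → ℝ) ≃L[ℝ] (Fin k → ℝ) :=
    (LinearEquiv.ofBijective (fstPart φ F).toLinearMap hb).toContinuousLinearEquiv
  refine ⟨(ContinuousLinearEquiv.unitsEquiv ℝ (Fin k → ℝ)).symm e, ?_⟩
  ext x
  rfl

/-- The linear map `ℝᵏ → ℝⁿ` sending the standard basis to the rows of a matrix. -/
def frameMap (A : FullRank k n) : (Fin k → ℝ) →L[ℝ] (Fin n → ℝ) :=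
  LinearMap.toContinuousLinearMap A.1.vecMulLinear

lemma range_frameMap (A : FullRank k n) :
    LinearMap.range (frameMap A).toLinearMap = (rowSpace A).1 :=
  range_vecMulLinear A.1

lemma frameMap_injective (A : FullRank k n) : Function.Injective (frameMap A) := by
  have h := (frameMap A).toLinearMap.finrank_range_add_finrank_ker
  rw [range_frameMap, (rowSpace A).2] at h
  have h0 : Module.finrank ℝ (LinearMap.ker (frameMap A).toLinearMap) = 0 := by
    simpa using h
  exact LinearMap.ker_eq_bot.1 (Submodule.finrank_eq_zero.1 h0)

lemma continuous_frameMap : Continuous (frameMap : FullRank k n → _) := by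
  let L : Matrix (Fin k) (Fin n) ℝ →ₗ[ℝ] ((Fin k → ℝ) →L[ℝ] (Fin n → ℝ)) :=
    { toFun := fun A => LinearMap.toContinuousLinearMap A.vecMulLinear
      map_add' := fun A B => by ext1 x; simp 
      map_smul' := fun c A => by ext1 x; simp  }
  exact L.continuous_of_finiteDimensional.comp continuous_subtype_val

lemma rowSpace_surjective : Function.Surjective (rowSpace : FullRank k n → _) := by
  rintro ⟨V, hV⟩
  let b := Module.finBasisOfFinrankEq ℝ V hV
  let A : Matrix (Fin k) (Fin n) ℝ := fun i => (b i : Fin n → ℝ)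
  have hA : Submodule.span ℝ (Set.range A.row) = V := by
    have : Set.range A.row = V.subtype '' Set.range b := by
      rw [← Set.range_comp]; rfl
    rw [this, Submodule.span_image, b.span_eq, Submodule.map_top, Submodule.range_subtype]
  refine ⟨⟨A, by rw [A.rank_eq_finrank_span_row, hA, hV]⟩, Subtype.ext hA⟩

lemma isQuotientMap_rowSpace : Topology.IsQuotientMap (rowSpace : FullRank k n → _) :=
  ⟨⟨rfl⟩, rowSpace_surjective⟩

lemma continuous_fstPart (φ : Splitting k n) : Continuous (fstPart φ) := by
  unfold fstPart
  exact continuous_const.clm_comp continuous_id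

lemma continuous_sndPart (φ : Splitting k n) : Continuous (sndPart φ) := by
  unfold sndPart
  exact continuous_const.clm_comp continuous_id

lemma preimage_range_graph (φ : Splitting k n) :
    rowSpace ⁻¹' Set.range (graph φ) = {A | IsUnit (fstPart φ (frameMap A))} := by
  ext A
  constructor
  · rintro ⟨B, hB⟩
    exact isUnit_fstPart φ _ (frameMap_injective A) B
      ((range_frameMap A).trans (congrArg Subtype.val hB.symm))
  · intro h
    exact ⟨_, Subtype.ext ((range_eq_graph φ _ h).symm.trans (range_frameMap A))⟩

lemma isOpen_range_graph (φ : Splitting k n) : IsOpen (Set.range (graph φ)) := by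
  rw [← isQuotientMap_rowSpace.isOpen_preimage, preimage_range_graph]
  exact Units.isOpen.preimage ((continuous_fstPart φ).comp continuous_frameMap)

lemma invFun_graph (φ : Splitting k n) (F : (Fin k → ℝ) →L[ℝ] (Fin n → ℝ))
    (h : IsUnit (fstPart φ F)) (V : RealGrassmannian k n)
    (hV : LinearMap.range F.toLinearMap = V.1) :
    Function.invFun (graph φ) V = sndPart φ F ∘L Ring.inverse (fstPart φ F) := by
  have : V = graph φ (sndPart φ F ∘L Ring.inverse (fstPart φ F)) :=
    Subtype.ext (hV.symm.trans (range_eq_graph φ F h))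
  rw [this]
  exact Function.leftInverse_invFun (graph_injective φ) _

lemma continuousOn_invFun_graph (φ : Splitting k n) :
    ContinuousOn (Function.invFun (graph φ)) (Set.range (graph φ)) := by
  rw [isQuotientMap_rowSpace.continuousOn_isOpen_iff (isOpen_range_graph φ), preimage_range_graph]
  have hc : ContinuousOn (fun A : FullRank k n =>
      sndPart φ (frameMap A) ∘L Ring.inverse (fstPart φ (frameMap A)))
      {A | IsUnit (fstPart φ (frameMap A))} := by
    refine ContinuousOn.clm_comp
      ((continuous_sndPart φ).comp continuous_frameMap).continuousOn ?_
    rintro A ⟨u, hu⟩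
    refine ContinuousAt.continuousWithinAt ?_
    refine ContinuousAt.comp (g := Ring.inverse) (f := fun A => fstPart φ (frameMap A)) ?_
      ((continuous_fstPart φ).comp continuous_frameMap).continuousAt
    rw [← hu]
    exact NormedRing.inverse_continuousAt u
  exact hc.congr fun A hA => invFun_graph φ _ hA _ (range_frameMap A)

lemma continuous_graph (φ : Splitting k n) : Continuous (graph φ) := by
  let m : Model k n → Matrix (Fin k) (Fin n) ℝ := fun B i => graphMap φ B (Pi.single i 1)
  have hm : ∀ B, Submodule.span ℝ (Set.range (m B).row) = (graph φ B).1 := fun B => by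
    rw [← range_vecMulLinear]
    change _ = LinearMap.range (graphMap φ B).toLinearMap
    congr 1
    refine LinearMap.pi_ext' fun i => LinearMap.ext_ring ?_
    simp only [LinearMap.comp_apply, LinearMap.single_apply, Matrix.vecMulLinear_apply]
    rw [Matrix.single_one_vecMul]
    rfl
  have hr : ∀ B, (m B).rank = k := fun B => by
    rw [Matrix.rank_eq_finrank_span_row, hm, (graph φ B).2]
  have hg : graph φ = rowSpace ∘ fun B => (⟨m B, hr B⟩ : FullRank k n) := by
    funext B
    exact Subtype.ext (hm B).symm
  rw [hg]
  refine isQuotientMap_rowSpace.continuous.comp (Continuous.subtype_mk ?_ hr)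
  refine continuous_pi fun i => ?_
  change Continuous fun B : Model k n => φ (Pi.single i 1, B (Pi.single i 1))
  fun_prop

/-- The affine chart attached to a splitting `φ : ℝᵏ × ℝⁿ⁻ᵏ ≃ ℝⁿ`: its domain is the set of
subspaces that are the graph of a linear map `ℝᵏ → ℝⁿ⁻ᵏ` (equivalently, that are complementary to
`φ (0 × ℝⁿ⁻ᵏ)`), and it sends a graph to the linear map. -/
def chart (φ : Splitting k n) : OpenPartialHomeomorph (RealGrassmannian k n) (Model k n) where
  toFun := Function.invFun (graph φ)
  invFun := graph φ
  source := Set.range (graph φ)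
  target := Set.univ
  map_source' _ _ := Set.mem_univ _
  map_target' B _ := ⟨B, rfl⟩
  left_inv' _ h := Function.invFun_eq h
  right_inv' B _ := Function.leftInverse_invFun (graph_injective φ) B
  open_source := isOpen_range_graph φ
  open_target := isOpen_univ
  continuousOn_toFun := continuousOn_invFun_graph φ
  continuousOn_invFun := (continuous_graph φ).continuousOn

lemma exists_splitting (V : RealGrassmannian k n) : ∃ φ : Splitting k n, V ∈ (chart φ).source := by
  obtain ⟨V, hV⟩ := V
  obtain ⟨W, hW⟩ := V.exists_isCompl
  have hW' : Module.finrank ℝ W = n - k := by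
    have := Submodule.finrank_add_eq_of_isCompl hW
    simp only [Module.finrank_fintype_fun_eq_card, Fintype.card_fin] at this
    omega
  let e : (Fin k → ℝ) ≃ₗ[ℝ] V := LinearEquiv.ofFinrankEq _ _ (by simp [hV])
  let f : (Fin (n - k) → ℝ) ≃ₗ[ℝ] W := LinearEquiv.ofFinrankEq _ _ (by simp [hW'])
  let φ : Splitting k n :=
    ((e.prodCongr f).trans (Submodule.prodEquivOfIsCompl V W hW)).toContinuousLinearEquiv
  refine ⟨φ, 0, Subtype.ext ?_⟩
  have hφ : ∀ x, graphMap φ 0 x = (e x : Fin n → ℝ) := fun x => by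
    simp [graphMap_apply, φ]
  ext v
  constructor
  · rintro ⟨x, rfl⟩
    exact (hφ x).symm ▸ (e x).2
  · intro hv
    refine ⟨e.symm ⟨v, hv⟩, (hφ _).trans ?_⟩
    simp

/-- The real Grassmannian with the atlas of all affine charts. -/
instance : ChartedSpace (Model k n) (RealGrassmannian k n) where
  atlas := Set.range chart
  chartAt V := chart (exists_splitting V).choose
  mem_chart_source V := (exists_splitting V).choose_spec
  chart_mem_atlas _ := ⟨_, rfl⟩

/-- The affine charts are smoothly compatible. -/
instance : IsManifold 𝓘(ℝ, Model k n) ∞ (RealGrassmannian k n) := by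
  refine isManifold_of_contDiffOn _ _ _ ?_
  rintro _ _ ⟨φ, rfl⟩ ⟨ψ, rfl⟩
  have hsub : ∀ B ∈ ((chart φ).symm.trans (chart ψ)).source,
      IsUnit (fstPart ψ (graphMap φ B)) := by
    rintro B ⟨-, C, hC⟩
    exact isUnit_fstPart ψ _ (graphMap_injective φ B) C (congrArg Subtype.val hC.symm)
  have hg : ContDiff ℝ ∞ (graphMap φ) := by
    have he : graphMap φ = fun B : Model k n =>
        (φ : _ →L[ℝ] (Fin n → ℝ)) ∘L (ContinuousLinearMap.inl ℝ (Fin k → ℝ) (Fin (n - k) → ℝ) +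
          ContinuousLinearMap.inr ℝ (Fin k → ℝ) (Fin (n - k) → ℝ) ∘L B) := by
      funext B
      ext1 x
      simp [graphMap_apply, ← map_add]
    rw [he]
    exact contDiff_const.clm_comp (contDiff_const.add (contDiff_const.clm_comp contDiff_id))
  have h1 : ContDiff ℝ ∞ fun B => fstPart ψ (graphMap φ B) := by
    unfold fstPart
    exact contDiff_const.clm_comp hg
  have h2 : ContDiff ℝ ∞ fun B => sndPart ψ (graphMap φ B) := by
    unfold sndPart
    exact contDiff_const.clm_comp hg
  have hc : ContDiffOn ℝ ∞ (fun B => sndPart ψ (graphMap φ B) ∘L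
      Ring.inverse (fstPart ψ (graphMap φ B))) ((chart φ).symm.trans (chart ψ)).source := by
    refine h2.contDiffOn.clm_comp ?_
    intro B hB
    obtain ⟨u, hu⟩ := hsub B hB
    refine ContDiffAt.contDiffWithinAt ?_
    refine ContDiffAt.comp (g := Ring.inverse) (f := fun B => fstPart ψ (graphMap φ B)) B ?_
      h1.contDiffAt
    rw [← hu]
    exact contDiffAt_ringInverse ℝ u
  have hmain := hc.congr (f₁ := (chart φ).symm.trans (chart ψ)) fun B hB =>
    invFun_graph ψ _ (hsub B hB) (graph φ B) rfl
  simpa using hmain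

end RealGrassmannian

/-- A smooth manifold `M` without boundary, modelled on a finite-dimensional real vector space `E`,
is orientable if its smooth structure admits an oriented atlas: a family of smooth charts that
covers `M` and whose coordinate changes all have positive Jacobian determinant. -/
def IsOrientableManifold (E : Type*) [NormedAddCommGroup E] [NormedSpace ℝ E]
    [FiniteDimensional ℝ E] (M : Type*) [TopologicalSpace M] [ChartedSpace E M]
    [IsManifold 𝓘(ℝ, E) ∞ M] : Prop :=
  ∃ A : Set (OpenPartialHomeomorph M E),
    A ⊆ IsManifold.maximalAtlas 𝓘(ℝ, E) ∞ M ∧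
    (∀ x : M, ∃ e ∈ A, x ∈ e.source) ∧
    ∀ e ∈ A, ∀ e' ∈ A, ∀ y ∈ (e.symm.trans e').source,
      0 < (fderiv ℝ (e.symm.trans e') y).det

end

open scoped Manifold ContDiff

noncomputable section

/-! Everything follows from a formula for the Jacobian of a coordinate change. For splittings `φ`,
`ψ`, put `M = ψ⁻¹ ∘ φ` and let `P` be the first component, seen through `ψ`, of `x ↦ φ (x, B x)`.
Then `det J * det P ^ n = det M ^ k` at `B` (`det_fderiv_transition_mul`), where `M` does not depend
on `B`. If `n` is even, the sign of `det J` is that of `det M ^ k`, so an oriented atlas is obtained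
by keeping the splittings for which this power, taken relative to a fixed reference, is positive.
Reversing `ℝᵏ` shows that the remaining charts still cover. If `n` is odd, `det J` changes sign with
`det P`. Some overlap contains points with `det P = 1` and `det P = -1` (`exists_fstPart_det`).
Orientability forbids this, because each chart has a connected image and so is either compatible
with the orientation throughout or opposite to it throughout (`det_fderiv_transition_mul_pos`). -/

/-! ### Determinants of two-sided multiplications and of block maps. -/

open Matrix Kronecker in
theorem det_comp_comp {k m : ℕ} (S : (Fin m → ℝ) →L[ℝ] (Fin m → ℝ))
    (T : (Fin k → ℝ) →L[ℝ] (Fin k → ℝ))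
    (F : ((Fin k → ℝ) →L[ℝ] (Fin m → ℝ)) →L[ℝ] ((Fin k → ℝ) →L[ℝ] (Fin m → ℝ)))
    (hF : ∀ H, F H = S ∘L H ∘L T) : F.det = S.det ^ k * T.det ^ m := by
  let e : ((Fin k → ℝ) →L[ℝ] (Fin m → ℝ)) ≃ₗ[ℝ] (Fin k × Fin m → ℝ) :=
    (LinearMap.toContinuousLinearMap.symm ≪≫ₗ LinearMap.toMatrix') ≪≫ₗ
      Matrix.transposeLinearEquiv _ _ ℝ ℝ ≪≫ₗ (LinearEquiv.curry ℝ ℝ (Fin k) (Fin m)).symm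
  have he : ∀ H, e H = vec (LinearMap.toMatrix' H.toLinearMap) := fun H => rfl
  -- Stacking the columns of `H` turns `H ↦ S H T` into the Kronecker product `Tᵀ ⊗ S`.
  have hconj : (e : _ →ₗ[ℝ] _) ∘ₗ F.toLinearMap ∘ₗ (e.symm : _ →ₗ[ℝ] _) =
      Matrix.toLin' ((LinearMap.toMatrix' T.toLinearMap)ᵀ ⊗ₖ
        LinearMap.toMatrix' S.toLinearMap) := by
    refine LinearMap.ext fun v => ?_
    obtain ⟨H, rfl⟩ := e.surjective v
    have hm : LinearMap.toMatrix' (S ∘L H ∘L T).toLinearMap =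
        LinearMap.toMatrix' S.toLinearMap * LinearMap.toMatrix' H.toLinearMap *
          LinearMap.toMatrix' T.toLinearMap := by
      rw [← LinearMap.toMatrix'_comp, ← LinearMap.toMatrix'_comp]
      rfl
    rw [LinearMap.comp_apply, LinearMap.comp_apply, LinearEquiv.coe_coe, LinearEquiv.coe_coe,
      LinearEquiv.symm_apply_apply, ContinuousLinearMap.coe_coe, hF, he, he, hm,
      Matrix.toLin'_apply, kronecker_mulVec_vec, transpose_transpose]
  rw [ContinuousLinearMap.det, ← LinearMap.det_conj F.toLinearMap e, hconj, LinearMap.det_toLin',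
    det_kronecker, det_transpose, LinearMap.det_toMatrix', LinearMap.det_toMatrix']
  simp [mul_comm, ContinuousLinearMap.det]

theorem LinearMap.det_prod_upper {V W : Type*} [AddCommGroup V] [Module ℝ V] [AddCommGroup W]
    [Module ℝ W] [FiniteDimensional ℝ V] [FiniteDimensional ℝ W] (p : V →ₗ[ℝ] V) (b : W →ₗ[ℝ] V)
    (s : W →ₗ[ℝ] W) :
    LinearMap.det ((p.coprod b).prod (s ∘ₗ LinearMap.snd ℝ V W)) =
      LinearMap.det p * LinearMap.det s := by
  classical
  let bV := Module.finBasis ℝ V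
  let bW := Module.finBasis ℝ W
  have h : LinearMap.toMatrix (bV.prod bW) (bV.prod bW)
      ((p.coprod b).prod (s ∘ₗ LinearMap.snd ℝ V W)) =
      Matrix.fromBlocks (LinearMap.toMatrix bV bV p) (LinearMap.toMatrix bW bV b) 0
        (LinearMap.toMatrix bW bW s) := by
    ext (i | i) (j | j) <;> simp [LinearMap.toMatrix_apply]
  rw [← LinearMap.det_toMatrix (bV.prod bW), h, Matrix.det_fromBlocks_zero₂₁,
    LinearMap.det_toMatrix, LinearMap.det_toMatrix]

theorem LinearMap.det_shear {V W : Type*} [AddCommGroup V] [Module ℝ V] [AddCommGroup W]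
    [Module ℝ W] [FiniteDimensional ℝ V] [FiniteDimensional ℝ W] (B : V →ₗ[ℝ] W) :
    LinearMap.det ((LinearMap.fst ℝ V W).prod (B.coprod LinearMap.id)) = 1 := by
  have h := LinearMap.det_prod_upper (LinearMap.id : W →ₗ[ℝ] W) B (LinearMap.id : V →ₗ[ℝ] V)
  rw [← LinearMap.det_conj _ (LinearEquiv.prodComm ℝ W V)] at h
  rw [LinearMap.det_id, LinearMap.det_id, mul_one] at h
  rw [← h]
  congr 1
  ext <;> simp

/-- The determinant of an endomorphism of a product that is upper block triangular after composing
with the shears `(x, y) ↦ (x, y + B x)` and `(x, y) ↦ (x, y - C x)`. -/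
theorem LinearMap.det_eq_of_shear {V W : Type*} [AddCommGroup V] [Module ℝ V] [AddCommGroup W]
    [Module ℝ W] [FiniteDimensional ℝ V] [FiniteDimensional ℝ W]
    (M : V × W →ₗ[ℝ] V × W) (B C : V →ₗ[ℝ] W)
    (h : ∀ x, (M (x, B x)).2 = C (M (x, B x)).1) :
    LinearMap.det M =
      LinearMap.det ((LinearMap.fst ℝ V W ∘ₗ M) ∘ₗ LinearMap.id.prod B) *
      LinearMap.det (((LinearMap.snd ℝ V W ∘ₗ M) - C ∘ₗ (LinearMap.fst ℝ V W ∘ₗ M)) ∘ₗ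
        LinearMap.inr ℝ V W) := by
  rw [← LinearMap.det_prod_upper _ (LinearMap.fst ℝ V W ∘ₗ M ∘ₗ LinearMap.inr ℝ V W) _]
  trans LinearMap.det ((LinearMap.fst ℝ V W).prod ((-C).coprod LinearMap.id)) *
    (LinearMap.det M * LinearMap.det ((LinearMap.fst ℝ V W).prod (B.coprod LinearMap.id)))
  · rw [LinearMap.det_shear, LinearMap.det_shear, mul_one, one_mul]
  rw [← LinearMap.det_comp, ← LinearMap.det_comp]
  congr 1
  refine LinearMap.ext fun ⟨x, y⟩ => ?_
  have hM : M (x, B x + y) = M (x, B x) + M (0, y) := by rw [← map_add]; simp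
  refine Prod.ext ?_ ?_
  · change (M (x, B x + y)).1 = (M (x, B x)).1 + (M (0, y)).1
    rw [hM, Prod.fst_add]
  · change -C (M (x, B x + y)).1 + (M (x, B x + y)).2 = (M (0, y)).2 - C (M (0, y)).1
    -- `M` carries the graph of `B` into the graph of `C`, so the lower left block vanishes after
    -- both shears.
    rw [hM, Prod.fst_add, Prod.snd_add, h, map_add]
    abel

/-! ### Signs of Jacobians and oriented atlases. -/

section Oriented

variable {E M : Type*} [NormedAddCommGroup E] [NormedSpace ℝ E]
  [TopologicalSpace M]

theorem det_fderiv_transition_self {e : OpenPartialHomeomorph M E} {x : M} (hx : x ∈ e.source) :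
    (fderiv ℝ (e.symm.trans e) (e x)).det = 1 := by
  have heq : (e.symm.trans e) =ᶠ[nhds (e x)] id := by
    filter_upwards [e.open_target.mem_nhds (e.map_source hx)] with y hy
    simp [hy]
  rw [heq.fderiv_eq, fderiv_id]
  simp [ContinuousLinearMap.det]

variable [ChartedSpace E M]

theorem contDiffOn_transition {e e' : OpenPartialHomeomorph M E}
    (he : e ∈ IsManifold.maximalAtlas 𝓘(ℝ, E) ∞ M)
    (he' : e' ∈ IsManifold.maximalAtlas 𝓘(ℝ, E) ∞ M) :
    ContDiffOn ℝ ∞ (e.symm.trans e') (e.symm.trans e').source := by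
  have h := contMDiffOn_of_mem_contDiffGroupoid
    (IsManifold.compatible_of_mem_maximalAtlas he he')
  exact contMDiffOn_iff_contDiffOn.1 h

theorem differentiableAt_transition {e e' : OpenPartialHomeomorph M E}
    (he : e ∈ IsManifold.maximalAtlas 𝓘(ℝ, E) ∞ M)
    (he' : e' ∈ IsManifold.maximalAtlas 𝓘(ℝ, E) ∞ M) {y : E}
    (hy : y ∈ (e.symm.trans e').source) : DifferentiableAt ℝ (e.symm.trans e') y :=
  ((contDiffOn_transition he he').contDiffAt
    ((e.symm.trans e').open_source.mem_nhds hy)).differentiableAt (by simp)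

/-- The chain rule makes Jacobian determinants a multiplicative cocycle; all sign comparisons
between charts rest on this. -/
theorem det_fderiv_transition_trans {e₁ e₂ e₃ : OpenPartialHomeomorph M E}
    (h₁ : e₁ ∈ IsManifold.maximalAtlas 𝓘(ℝ, E) ∞ M)
    (h₂ : e₂ ∈ IsManifold.maximalAtlas 𝓘(ℝ, E) ∞ M)
    (h₃ : e₃ ∈ IsManifold.maximalAtlas 𝓘(ℝ, E) ∞ M)
    {x : M} (hx₁ : x ∈ e₁.source) (hx₂ : x ∈ e₂.source) (hx₃ : x ∈ e₃.source) :
    (fderiv ℝ (e₁.symm.trans e₃) (e₁ x)).det =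
      (fderiv ℝ (e₂.symm.trans e₃) (e₂ x)).det * (fderiv ℝ (e₁.symm.trans e₂) (e₁ x)).det := by
  have m₁₂ : e₁ x ∈ (e₁.symm.trans e₂).source := by simp [hx₁, hx₂]
  have m₂₃ : e₂ x ∈ (e₂.symm.trans e₃).source := by simp [hx₂, hx₃]
  have hval : (e₁.symm.trans e₂) (e₁ x) = e₂ x := by simp [hx₁]
  have d₁₂ := differentiableAt_transition h₁ h₂ m₁₂
  have d₂₃ := differentiableAt_transition h₂ h₃ m₂₃
  rw [← hval] at d₂₃
  have heq : (e₁.symm.trans e₃) =ᶠ[nhds (e₁ x)] (e₂.symm.trans e₃) ∘ (e₁.symm.trans e₂) := by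
    filter_upwards [(e₁.symm.trans e₂).open_source.mem_nhds m₁₂] with y hy
    have : e₁.symm y ∈ e₂.source := by simpa using hy.2
    simp [this]
  rw [heq.fderiv_eq, fderiv_comp _ d₂₃ d₁₂, hval]
  exact LinearMap.det_comp _ _

theorem det_fderiv_transition_ne_zero {e e' : OpenPartialHomeomorph M E}
    (he : e ∈ IsManifold.maximalAtlas 𝓘(ℝ, E) ∞ M)
    (he' : e' ∈ IsManifold.maximalAtlas 𝓘(ℝ, E) ∞ M)
    {x : M} (hx : x ∈ e.source) (hx' : x ∈ e'.source) :
    (fderiv ℝ (e.symm.trans e') (e x)).det ≠ 0 := by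
  intro h
  have h1 := det_fderiv_transition_trans he he' he hx hx' hx
  rw [h, det_fderiv_transition_self hx] at h1
  simp at h1

theorem isOpen_det_fderiv_transition {e e' : OpenPartialHomeomorph M E}
    (he : e ∈ IsManifold.maximalAtlas 𝓘(ℝ, E) ∞ M)
    (he' : e' ∈ IsManifold.maximalAtlas 𝓘(ℝ, E) ∞ M) {U : Set ℝ} (hU : IsOpen U) :
    IsOpen ((e.symm.trans e').source ∩
      (fun y => (fderiv ℝ (e.symm.trans e') y).det) ⁻¹' U) := by
  refine ContinuousOn.isOpen_inter_preimage ?_ (e.symm.trans e').open_source hU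
  exact ContinuousLinearMap.continuous_det.comp_continuousOn
    ((contDiffOn_transition he he').continuousOn_fderiv_of_isOpen
      (e.symm.trans e').open_source (by simp))

/-- Along a chart with connected image, the orientation of the chart relative to an oriented atlas
does not change. -/
theorem det_fderiv_transition_oriented {A : Set (OpenPartialHomeomorph M E)}
    (hA : A ⊆ IsManifold.maximalAtlas 𝓘(ℝ, E) ∞ M)
    (hcov : ∀ x : M, ∃ e ∈ A, x ∈ e.source)
    (hpos : ∀ e ∈ A, ∀ e' ∈ A, ∀ y ∈ (e.symm.trans e').source,
      0 < (fderiv ℝ (e.symm.trans e') y).det)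
    {e : OpenPartialHomeomorph M E} (he : e ∈ IsManifold.maximalAtlas 𝓘(ℝ, E) ∞ M)
    (hconn : IsPreconnected e.target) {a b : OpenPartialHomeomorph M E} (ha : a ∈ A) (hb : b ∈ A)
    {x y : M} (hx : x ∈ e.source) (hxa : x ∈ a.source) (hy : y ∈ e.source) (hyb : y ∈ b.source) :
    0 < (fderiv ℝ (e.symm.trans a) (e x)).det * (fderiv ℝ (e.symm.trans b) (e y)).det := by
  -- The sets for positive and negative Jacobians are open and cover `e.target`. They are disjoint
  -- because charts of `A` agree on the sign at each point, so connectedness leaves only one.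
  let S (U : Set ℝ) : Set E := ⋃ c ∈ A, ((e.symm.trans c).source ∩
      (fun z => (fderiv ℝ (e.symm.trans c) z).det) ⁻¹' U)
  have hS : ∀ {U : Set ℝ} {c} {z}, c ∈ A → z ∈ e.source → z ∈ c.source →
      (fderiv ℝ (e.symm.trans c) (e z)).det ∈ U → e z ∈ S U := by
    intro U c z hc hz hzc hU
    exact Set.mem_biUnion hc ⟨by simp [hz, hzc], hU⟩
  have hopen : ∀ {U : Set ℝ}, IsOpen U → IsOpen (S U) := fun hU =>
    isOpen_biUnion fun c hc => isOpen_det_fderiv_transition he (hA hc) hU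
  have hcompare : ∀ {c d z}, c ∈ A → d ∈ A → z ∈ e.source → z ∈ c.source → z ∈ d.source →
      0 < (fderiv ℝ (e.symm.trans c) (e z)).det → 0 < (fderiv ℝ (e.symm.trans d) (e z)).det := by
    intro c d z hc hd hz hzc hzd h
    rw [det_fderiv_transition_trans he (hA hc) (hA hd) hz hzc hzd]
    exact mul_pos (hpos c hc d hd _ (by simp [hzc, hzd])) h
  have hdisj : Disjoint (S (Set.Ioi 0)) (S (Set.Iio 0)) := by
    rw [Set.disjoint_left]
    intro w h1 h2
    obtain ⟨c, hc, hwc, hcp⟩ := Set.mem_iUnion₂.1 h1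
    obtain ⟨d, hd, hwd, hdn⟩ := Set.mem_iUnion₂.1 h2
    have hw : e (e.symm w) = w := e.right_inv hwc.1
    have hcp' : 0 < (fderiv ℝ (e.symm.trans c) w).det := hcp
    have hdn' : (fderiv ℝ (e.symm.trans d) w).det < 0 := hdn
    rw [← hw] at hcp' hdn'
    exact absurd (hcompare hc hd (e.map_target hwc.1) hwc.2 hwd.2 hcp') hdn'.not_gt
  have hsub : e.target ⊆ S (Set.Ioi 0) ∪ S (Set.Iio 0) := by
    intro w hw
    obtain ⟨c, hc, hwc⟩ := hcov (e.symm w)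
    rw [← e.right_inv hw]
    rcases (det_fderiv_transition_ne_zero he (hA hc) (e.map_target hw) hwc).lt_or_gt with h | h
    · exact Or.inr (hS hc (e.map_target hw) hwc h)
    · exact Or.inl (hS hc (e.map_target hw) hwc h)
  have hval : ∀ {U c z}, c ∈ A → z ∈ e.source → z ∈ c.source → e.target ⊆ S U →
      ∃ d ∈ A, z ∈ d.source ∧ (fderiv ℝ (e.symm.trans d) (e z)).det ∈ U := by
    intro U c z hc hz hzc h
    obtain ⟨d, hd, hzd, hU⟩ := Set.mem_iUnion₂.1 (h (e.map_source hz))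
    exact ⟨d, hd, by simpa [hz] using hzd, hU⟩
  rcases (det_fderiv_transition_ne_zero he (hA ha) hx hxa).lt_or_gt with h | h
  · have hall := hconn.subset_left_of_subset_union (hopen isOpen_Iio) (hopen isOpen_Ioi)
      hdisj.symm (by rwa [Set.union_comm]) ⟨e x, e.map_source hx, hS ha hx hxa h⟩
    refine mul_pos_of_neg_of_neg h ?_
    obtain ⟨d, hd, hyd, hneg⟩ := hval hb hy hyb hall
    refine lt_of_not_ge fun hge => absurd (hcompare hb hd hy hyb hyd
      (lt_of_le_of_ne hge (det_fderiv_transition_ne_zero he (hA hb) hy hyb).symm)) ?_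
    exact not_lt.2 (le_of_lt hneg)
  · have hall := hconn.subset_left_of_subset_union (hopen isOpen_Ioi) (hopen isOpen_Iio)
      hdisj hsub ⟨e x, e.map_source hx, hS ha hx hxa h⟩
    refine mul_pos h ?_
    obtain ⟨d, hd, hyd, hp⟩ := hval hb hy hyb hall
    exact hcompare hd hb hy hyd hyb hp

variable [FiniteDimensional ℝ E]

/-- On an orientable manifold, the Jacobian of the transition map between two charts with connected
images has constant sign. -/
theorem IsOrientableManifold.det_fderiv_transition_mul_pos [IsManifold 𝓘(ℝ, E) ∞ M]
    (h : IsOrientableManifold E M) {e e' : OpenPartialHomeomorph M E}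
    (he : e ∈ IsManifold.maximalAtlas 𝓘(ℝ, E) ∞ M)
    (he' : e' ∈ IsManifold.maximalAtlas 𝓘(ℝ, E) ∞ M)
    (hconn : IsPreconnected e.target) (hconn' : IsPreconnected e'.target)
    {x y : M} (hx : x ∈ e.source) (hx' : x ∈ e'.source) (hy : y ∈ e.source) (hy' : y ∈ e'.source) :
    0 < (fderiv ℝ (e.symm.trans e') (e x)).det * (fderiv ℝ (e.symm.trans e') (e y)).det := by
  obtain ⟨A, hA, hcov, hpos⟩ := h
  obtain ⟨a, ha, hxa⟩ := hcov x
  obtain ⟨b, hb, hyb⟩ := hcov y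
  have h1 := det_fderiv_transition_oriented hA hcov hpos he hconn ha hb hx hxa hy hyb
  have h2 := det_fderiv_transition_oriented hA hcov hpos he' hconn' ha hb hx' hxa hy' hyb
  -- Passing through `e'` splits the positive product for `e` into the positive product for `e'`
  -- times the desired one.
  rw [det_fderiv_transition_trans he he' (hA ha) hx hx' hxa,
    det_fderiv_transition_trans he he' (hA hb) hy hy' hyb, mul_mul_mul_comm] at h1
  exact pos_of_mul_pos_right h1 h2.le

end Oriented

/-! ### The Jacobian of a change of affine charts. -/

namespace RealGrassmannian

variable {k n : ℕ}

theorem isUnit_fstPart_of_mem {φ ψ : Splitting k n} {B : Model k n}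
    (hB : B ∈ ((chart φ).symm.trans (chart ψ)).source) : IsUnit (fstPart ψ (graphMap φ B)) := by
  obtain ⟨-, C, hC⟩ := hB
  exact isUnit_fstPart ψ _ (graphMap_injective φ B) C (congrArg Subtype.val hC.symm)

/-- Clearing the inverse from `f = Q P⁻¹` gives `f P = Q` with `P` and `Q` affine in `B`, so the
product rule suffices to differentiate it. -/
theorem transition_comp_fstPart {φ ψ : Splitting k n} {B : Model k n}
    (hB : B ∈ ((chart φ).symm.trans (chart ψ)).source) :
    ((chart φ).symm.trans (chart ψ)) B ∘L fstPart ψ (graphMap φ B) =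
      sndPart ψ (graphMap φ B) := by
  have hu := isUnit_fstPart_of_mem hB
  have h : ((chart φ).symm.trans (chart ψ)) B = sndPart ψ (graphMap φ B) ∘L
      Ring.inverse (fstPart ψ (graphMap φ B)) := invFun_graph ψ _ hu (graph φ B) rfl
  rw [h, ContinuousLinearMap.comp_assoc, ← ContinuousLinearMap.mul_def,
    Ring.inverse_mul_cancel _ hu]
  rfl

theorem chart_mem_maximalAtlas (φ : Splitting k n) :
    chart φ ∈ IsManifold.maximalAtlas 𝓘(ℝ, Model k n) ∞ (RealGrassmannian k n) :=
  IsManifold.subset_maximalAtlas ⟨φ, rfl⟩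

/-- The Jacobian determinant of the transition map between two affine charts. -/
theorem det_fderiv_transition_mul {φ ψ : Splitting k n} {B : Model k n}
    (hB : B ∈ ((chart φ).symm.trans (chart ψ)).source) (hkn : k ≤ n) :
    (fderiv ℝ ((chart φ).symm.trans (chart ψ)) B).det * (fstPart ψ (graphMap φ B)).det ^ n =
      LinearMap.det (φ.trans ψ.symm).toLinearEquiv.toLinearMap ^ k := by
  set M : ((Fin k → ℝ) × (Fin (n - k) → ℝ)) →L[ℝ] ((Fin k → ℝ) × (Fin (n - k) → ℝ)) :=
    (φ.trans ψ.symm).toContinuousLinearMap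
  set f := (chart φ).symm.trans (chart ψ)
  set J := fderiv ℝ f B
  -- `b` and `d` form the second block column of `M`; `H ↦ b H` and `H ↦ d H` are the linear parts
  -- of `P` and `Q`.
  let b := (ContinuousLinearMap.fst ℝ (Fin k → ℝ) (Fin (n - k) → ℝ) ∘L M) ∘L
    ContinuousLinearMap.inr ℝ (Fin k → ℝ) (Fin (n - k) → ℝ)
  let d := (ContinuousLinearMap.snd ℝ (Fin k → ℝ) (Fin (n - k) → ℝ) ∘L M) ∘L
    ContinuousLinearMap.inr ℝ (Fin k → ℝ) (Fin (n - k) → ℝ)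
  have hgr : ∀ C x, graphMap φ C x = graphMap φ 0 x + φ (0, C x) := fun C x => by
    simp [graphMap_apply, ← map_add]
  have hP : HasFDerivAt (fun C => fstPart ψ (graphMap φ C))
      (ContinuousLinearMap.compL ℝ (Fin k → ℝ) (Fin (n - k) → ℝ) (Fin k → ℝ) b) B := by
    have : (fun C => fstPart ψ (graphMap φ C)) = fun C => fstPart ψ (graphMap φ 0) +
        ContinuousLinearMap.compL ℝ (Fin k → ℝ) (Fin (n - k) → ℝ) (Fin k → ℝ) b C := by
      ext C x
      change (ψ.symm (graphMap φ C x)).1 _ =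
        (ψ.symm (graphMap φ 0 x)).1 _ + (ψ.symm (φ (0, C x))).1 _
      rw [hgr C x, map_add]
      rfl
    rw [this]
    exact (ContinuousLinearMap.hasFDerivAt _).const_add _
  have hQ : HasFDerivAt (fun C => sndPart ψ (graphMap φ C))
      (ContinuousLinearMap.compL ℝ (Fin k → ℝ) (Fin (n - k) → ℝ) (Fin (n - k) → ℝ) d) B := by
    have : (fun C => sndPart ψ (graphMap φ C)) = fun C => sndPart ψ (graphMap φ 0) +
        ContinuousLinearMap.compL ℝ (Fin k → ℝ) (Fin (n - k) → ℝ) (Fin (n - k) → ℝ) d C := by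
      ext C x
      change (ψ.symm (graphMap φ C x)).2 _ =
        (ψ.symm (graphMap φ 0 x)).2 _ + (ψ.symm (φ (0, C x))).2 _
      rw [hgr C x, map_add]
      rfl
    rw [this]
    exact (ContinuousLinearMap.hasFDerivAt _).const_add _
  have hfd : HasFDerivAt f J B := (differentiableAt_transition (chart_mem_maximalAtlas φ)
    (chart_mem_maximalAtlas ψ) hB).hasFDerivAt
  have heq : (fun C => f C ∘L fstPart ψ (graphMap φ C)) =ᶠ[nhds B]
      fun C => sndPart ψ (graphMap φ C) := by
    filter_upwards [f.open_source.mem_nhds hB] with C hC using transition_comp_fstPart hC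
  have huniq := (hfd.clm_comp hP).unique (hQ.congr_of_eventuallyEq heq)
  -- Differentiating `f P = Q` in the direction `H` gives `J H ∘ P + f B ∘ b ∘ H = d ∘ H`.
  have key : ∀ H, J H ∘L fstPart ψ (graphMap φ B) = (d - f B ∘L b) ∘L H := fun H => by
    have h := congrArg (fun T => T H) huniq
    simp only [add_apply, ContinuousLinearMap.comp_apply,
      ContinuousLinearMap.compL_apply, ContinuousLinearMap.flip_apply] at h
    rw [ContinuousLinearMap.sub_comp, ← h, ContinuousLinearMap.comp_assoc]
    exact (add_sub_cancel_left _ _).symm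
  let R := (ContinuousLinearMap.compL ℝ (Fin k → ℝ) (Fin k → ℝ) (Fin (n - k) → ℝ)).flip
    (fstPart ψ (graphMap φ B))
  have hR : R.det = (fstPart ψ (graphMap φ B)).det ^ (n - k) := by
    rw [det_comp_comp (ContinuousLinearMap.id ℝ _) (fstPart ψ (graphMap φ B)) R fun H => rfl]
    simp [ContinuousLinearMap.det]
  have hRJ : (R ∘L J).det = (d - f B ∘L b).det ^ k := by
    rw [det_comp_comp (d - f B ∘L b) (ContinuousLinearMap.id ℝ _) (R ∘L J) fun H => key H]
    simp [ContinuousLinearMap.det]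
  have hmul : (R ∘L J).det = R.det * J.det := LinearMap.det_comp _ _
  -- `M` sends the graph of `B` to that of `f B`; after shearing, its diagonal blocks are `P` and `d
  -- - f B ∘ b`.
  have hdet : LinearMap.det (φ.trans ψ.symm).toLinearEquiv.toLinearMap =
      (fstPart ψ (graphMap φ B)).det * (d - f B ∘L b).det :=
    LinearMap.det_eq_of_shear M.toLinearMap B.toLinearMap (f B).toLinearMap fun x =>
      (congrArg (fun T => T x) (transition_comp_fstPart hB)).symm
  rw [hdet, mul_pow, ← hRJ, hmul, hR, ← mul_assoc, ← pow_add, Nat.add_sub_of_le hkn, mul_comm]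

theorem mem_transition_source {φ ψ : Splitting k n} {B : Model k n}
    (h : (fstPart ψ (graphMap φ B)).det ≠ 0) :
    B ∈ ((chart φ).symm.trans (chart ψ)).source := by
  refine ⟨Set.mem_univ _, _, Subtype.ext (range_eq_graph ψ (graphMap φ B) ?_).symm⟩
  refine ⟨(ContinuousLinearEquiv.unitsEquiv ℝ _).symm
    (ContinuousLinearMap.toContinuousLinearEquivOfDetNeZero _ h), ?_⟩
  ext x
  rfl

theorem det_splitting_trans (φ ψ χ : Splitting k n) :
    LinearMap.det (φ.trans χ.symm).toLinearEquiv.toLinearMap =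
      LinearMap.det (ψ.trans χ.symm).toLinearEquiv.toLinearMap *
        LinearMap.det (φ.trans ψ.symm).toLinearEquiv.toLinearMap := by
  rw [← LinearMap.det_comp]
  congr 1
  refine LinearMap.ext fun x => ?_
  change χ.symm (φ x) = χ.symm (ψ (ψ.symm (φ x)))
  rw [ψ.apply_symm_apply]

theorem exists_reference_splitting (hkn : k ≤ n) : Nonempty (Splitting k n) :=
  ⟨ContinuousLinearEquiv.ofFinrankEq (by simp [hkn])⟩

/-- The splitting obtained by changing the sign of the first factor. -/
def negFst (φ : Splitting k n) : Splitting k n :=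
  ((ContinuousLinearEquiv.neg ℝ).prodCongr (ContinuousLinearEquiv.refl ℝ _)).trans φ

/-- The sign change only reparametrizes the graph, so a chart can be replaced by its reversed
version without losing a point. -/
theorem graph_negFst (φ : Splitting k n) (B : Model k n) :
    graph (negFst φ) (-B) = graph φ B := by
  have h : ∀ x, graphMap (negFst φ) (-B) x = graphMap φ B (-x) := fun x => by
    simp [graphMap_apply, negFst]
  refine Subtype.ext (Submodule.ext fun v => ⟨?_, ?_⟩)
  · rintro ⟨x, rfl⟩
    exact ⟨-x, (h x).symm⟩
  · rintro ⟨x, rfl⟩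
    exact ⟨-x, (h _).trans (by rw [neg_neg]; rfl)⟩

theorem det_negFst (φ ψ : Splitting k n) :
    LinearMap.det ((negFst φ).trans ψ.symm).toLinearEquiv.toLinearMap =
      LinearMap.det (φ.trans ψ.symm).toLinearEquiv.toLinearMap * (-1) ^ k := by
  have h : LinearMap.det ((-LinearMap.id : (Fin k → ℝ) →ₗ[ℝ] (Fin k → ℝ)).prodMap
      (LinearMap.id : (Fin (n - k) → ℝ) →ₗ[ℝ] (Fin (n - k) → ℝ))) = (-1) ^ k := by
    rw [LinearMap.det_prodMap, ← neg_one_smul ℝ LinearMap.id, LinearMap.det_smul]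
    simp
  rw [← h, ← LinearMap.det_comp]
  rfl

/-! ### An oriented atlas for even `n`. -/

theorem isOrientableManifold_of_even (hkn : k ≤ n) (hn : Even n) :
    IsOrientableManifold (Model k n) (RealGrassmannian k n) := by
  obtain ⟨χ⟩ := exists_reference_splitting hkn
  refine ⟨chart '' {φ | 0 < LinearMap.det (φ.trans χ.symm).toLinearEquiv.toLinearMap ^ k},
    ?_, fun V => ?_, ?_⟩
  · rintro _ ⟨φ, -, rfl⟩
    exact chart_mem_maximalAtlas φ
  · obtain ⟨φ, B, hB⟩ := exists_splitting V
    have hne : LinearMap.det (φ.trans χ.symm).toLinearEquiv.toLinearMap ≠ 0 :=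
      (LinearEquiv.isUnit_det' _).ne_zero
    rcases (pow_ne_zero k hne).lt_or_gt with h | h
    -- A negative `k`-th power forces `k` odd, and then reversing `ℝᵏ` negates the determinant and
    -- hence its `k`-th power.
    · have hk : Odd k := Nat.not_even_iff_odd.1 fun hk => (hk.pow_nonneg _).not_gt h
      refine ⟨_, ⟨negFst φ, ?_, rfl⟩, -B, (graph_negFst φ B).trans hB⟩
      rw [Set.mem_ofPred_eq]
      rw [det_negFst, hk.neg_one_pow, mul_neg_one, hk.neg_pow]
      exact neg_pos.2 h
    · exact ⟨_, ⟨φ, h, rfl⟩, B, hB⟩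
  · rintro _ ⟨φ, hφ, rfl⟩ _ ⟨ψ, hψ, rfl⟩ B hB
    have hφ' : 0 < LinearMap.det (φ.trans χ.symm).toLinearEquiv.toLinearMap ^ k := hφ
    rw [det_splitting_trans φ ψ χ, mul_pow] at hφ'
    have hD := pos_of_mul_pos_right hφ' (le_of_lt hψ)
    rw [← det_fderiv_transition_mul hB hkn] at hD
    -- The factor `det P ^ n` is nonnegative for even `n`, so the Jacobian itself is positive.
    exact pos_of_mul_pos_left hD (hn.pow_nonneg _)

/-! ### The obstruction for odd `n`. -/

/-- The splitting `(x, y) ↦ φ (x - b y, y)`. -/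
def shear (φ : Splitting k n) (b : (Fin (n - k) → ℝ) →ₗ[ℝ] (Fin k → ℝ)) : Splitting k n :=
  LinearEquiv.toContinuousLinearEquiv
    (LinearEquiv.trans
      { toFun := fun p => (p.1 - b p.2, p.2)
        invFun := fun p => (p.1 + b p.2, p.2)
        map_add' := fun p q => by ext <;> simp; ring
        map_smul' := fun c p => by ext <;> simp [mul_sub]
        left_inv := fun p => by simp
        right_inv := fun p => by simp } φ.toLinearEquiv)

theorem fstPart_shear (φ : Splitting k n) (b : (Fin (n - k) → ℝ) →ₗ[ℝ] (Fin k → ℝ))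
    (B : Model k n) (x : Fin k → ℝ) :
    fstPart (shear φ b) (graphMap φ B) x = x + b (B x) := by
  have h : (shear φ b).symm (φ (x, B x)) = (x + b (B x), B x) := by
    rw [ContinuousLinearEquiv.symm_apply_eq]
    change _ = φ (x + b (B x) - b (B x), B x)
    rw [add_sub_cancel_right]
  exact congrArg Prod.fst h

theorem exists_fstPart_det (hk : 0 < k) (hkn : k < n) :
    ∃ (φ ψ : Splitting k n) (B C : Model k n),
      (fstPart ψ (graphMap φ B)).det = 1 ∧ (fstPart ψ (graphMap φ C)).det = -1 := by
  obtain ⟨φ⟩ := exists_reference_splitting hkn.le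
  let i : Fin k := ⟨0, hk⟩
  let j : Fin (n - k) := ⟨0, Nat.sub_pos_of_lt hkn⟩
  -- Here `P = 1 + b C`. The zero map gives the identity, while the coefficient `-2` turns one
  -- diagonal entry into `1 - 2 = -1`; this needs a coordinate in each factor, hence `0 < k < n`.
  let b : (Fin (n - k) → ℝ) →ₗ[ℝ] (Fin k → ℝ) :=
    LinearMap.single ℝ (fun _ : Fin k => ℝ) i ∘ₗ LinearMap.proj j
  let C : (Fin k → ℝ) →ₗ[ℝ] (Fin (n - k) → ℝ) :=
    (-2 : ℝ) • LinearMap.single ℝ (fun _ : Fin (n - k) => ℝ) j ∘ₗ LinearMap.proj i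
  refine ⟨φ, shear φ b, 0, LinearMap.toContinuousLinearMap C, ?_, ?_⟩
  · have h : fstPart (shear φ b) (graphMap φ 0) = ContinuousLinearMap.id ℝ _ := by
      ext1 x
      simp [fstPart_shear]
    rw [h]
    simp [ContinuousLinearMap.det]
  · have h : (fstPart (shear φ b) (graphMap φ (LinearMap.toContinuousLinearMap C))).toLinearMap =
        Matrix.toLin' (Matrix.diagonal (Function.update 1 i (-1))) := by
      refine LinearMap.ext fun x => funext fun l => ?_
      rw [ContinuousLinearMap.coe_coe, fstPart_shear, Matrix.toLin'_apply, Matrix.mulVec_diagonal]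
      rcases eq_or_ne l i with rfl | hl
      · simp [b, C]
        ring
      · simp [b, C, hl]
    rw [ContinuousLinearMap.det, h, LinearMap.det_toLin', Matrix.det_diagonal,
      Finset.prod_update_of_mem (Finset.mem_univ i)]
    simp

theorem even_of_isOrientableManifold (hk : 0 < k) (hkn : k < n)
    (h : IsOrientableManifold (Model k n) (RealGrassmannian k n)) : Even n := by
  by_contra hn
  rw [Nat.not_even_iff_odd] at hn
  obtain ⟨φ, ψ, B, C, hB, hC⟩ := exists_fstPart_det hk hkn
  have mB : B ∈ ((chart φ).symm.trans (chart ψ)).source := mem_transition_source (by simp [hB])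
  have mC : C ∈ ((chart φ).symm.trans (chart ψ)).source := mem_transition_source (by simp [hC])
  -- Only the chart images need be connected, and each is the whole model space; `B` and `C` may lie
  -- in different components of the overlap.
  have hpos := h.det_fderiv_transition_mul_pos (chart_mem_maximalAtlas φ)
    (chart_mem_maximalAtlas ψ) isPreconnected_univ isPreconnected_univ
    ((chart φ).map_target mB.1) mB.2 ((chart φ).map_target mC.1) mC.2
  rw [(chart φ).right_inv mB.1, (chart φ).right_inv mC.1] at hpos
  have eB := det_fderiv_transition_mul mB hkn.le
  have eC := det_fderiv_transition_mul mC hkn.le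
  rw [hB, one_pow, mul_one] at eB
  -- Both Jacobians are computed from the same `det M ^ k`, so for odd `n` they are opposite.
  rw [hC, hn.neg_one_pow, mul_neg_one, ← eB] at eC
  rw [← eC, neg_mul] at hpos
  exact (neg_pos.1 hpos).not_ge (mul_self_nonneg _)

end RealGrassmannian

end

theorem corollary3p6 (k n : ℕ) (hk : 0 < k) (hkn : k < n) :
    IsOrientableManifold (RealGrassmannian.Model k n) (RealGrassmannian k n) ↔ Even n :=
  ⟨RealGrassmannian.even_of_isOrientableManifold hk hkn,
    RealGrassmannian.isOrientableManifold_of_even hkn.le⟩
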